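/- **Theorem (Schottky's theorem in $\mathbb{C}^n$).** Let $n\ge 1$, let $\Omega\subset\mathbb{C}^n$ be a bounded domain (a nonempty, bounded, connected open set), let $a\in\Omega$, and let $M\in\mathbb{R}$ and $\varepsilon>0$. Then there is a constant $C>0$, depending only on $\Omega$, $a$, $M$ and $\varepsilon$, such that for every holomorphic function $f:\Omega\to\mathbb{C}$ which omits the values $0$ and $1$ and satisfies $|f(a)|<M$ we have $$|f(z)|<C\qquad\text{for all } z\in\Omega \text{ with } \delta(z)\ge\varepsilon,$$ where $\delta(z)$ denotes the Euclidean distance from $z$ to the boundary $\partial\Omega$. -/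

import Mathlib

/-! On the unit disc, write `2f - 1 = cos (πF)`. Since `f` omits `0` and `1`, `F` omits every
integer, so in turn `F = cos (πg)`. Then `g` omits every point where `cos (πv)` is an integer, and
these points are `3/2`-dense, so the image of `g` contains no large disc. Bloch's theorem therefore
bounds `g'` on the half disc; integrating from `g 0`, which is controlled by `f 0`, bounds `g`,
hence `f`. Restriction to complex lines gives the same constant on all balls; connectedness and
compactness do the rest. -/

/-! ### Holomorphic logarithms and inverse cosines on a disc -/

/-- A nonvanishing holomorphic function on a disc has a holomorphic logarithm. -/
theorem exists_differentiableOn_exp_eq {f : ℂ → ℂ} {c : ℂ} {r : ℝ}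
    (hf : DifferentiableOn ℂ f (Metric.ball c r)) (h0 : ∀ z ∈ Metric.ball c r, f z ≠ 0) :
    ∃ L : ℂ → ℂ, DifferentiableOn ℂ L (Metric.ball c r) ∧
      ∀ z ∈ Metric.ball c r, f z = Complex.exp (L z) := by
  rcases le_or_gt r 0 with hr | hr
  · exact ⟨0, by simp [Metric.ball_eq_empty.2 hr], by simp [Metric.ball_eq_empty.2 hr]⟩
  have hc : c ∈ Metric.ball c r := Metric.mem_ball_self hr
  have hd : DifferentiableOn ℂ (fun z => deriv f z / f z) (Metric.ball c r) :=
    (hf.deriv Metric.isOpen_ball).div hf h0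
  obtain ⟨G, hGc, hG⟩ := hd.isExactOn_ball.with_val_at c (Complex.log (f c))
  have hfd : ∀ z ∈ Metric.ball c r, HasDerivAt f (deriv f z) z := fun z hz =>
    (hf.differentiableAt (Metric.isOpen_ball.mem_nhds hz)).hasDerivAt
  have hq : ∀ z ∈ Metric.ball c r,
      HasDerivAt (fun z => f z * Complex.exp (-G z)) 0 z := by
    intro z hz
    have h := (hfd z hz).mul (hG z hz).neg.cexp
    have e : deriv f z * Complex.exp (-G z)
        + f z * (Complex.exp (-G z) * -(deriv f z / f z)) = 0 := by
      have := h0 z hz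
      field_simp
      ring
    exact e ▸ h
  refine ⟨G, fun z hz => (hG z hz).differentiableAt.differentiableWithinAt, fun z hz => ?_⟩
  have hconst : f z * Complex.exp (-G z) = f c * Complex.exp (-G c) :=
    Metric.isOpen_ball.is_const_of_deriv_eq_zero (convex_ball c r).isPreconnected
      (fun w hw => (hq w hw).differentiableAt.differentiableWithinAt)
      (fun w hw => (hq w hw).deriv) hz hc
  rw [hGc, Complex.exp_neg, Complex.exp_neg, Complex.exp_log (h0 c hc),
    mul_inv_cancel₀ (h0 c hc)] at hconst
  field_simp at hconst
  exact hconst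

/-- From `|cos (x + iy)|² = cos² x + sinh² y`. It controls the imaginary part of an inverse cosine.
-/
theorem abs_im_le_norm_cos (z : ℂ) : |z.im| ≤ ‖Complex.cos z‖ := by
  have hn : ‖Complex.cos z‖ ^ 2 = Real.cos z.re ^ 2 + Real.sinh z.im ^ 2 := by
    rw [Complex.cos_eq, ← Complex.normSq_eq_norm_sq]
    have : Complex.cos z.re * Complex.cosh z.im - Complex.sin z.re * Complex.sinh z.im * Complex.I
        = ((Real.cos z.re * Real.cosh z.im : ℝ) : ℂ)
          + ((-(Real.sin z.re * Real.sinh z.im) : ℝ) : ℂ) * Complex.I := by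
      push_cast
      ring
    rw [this, Complex.normSq_add_mul_I]
    have h1 := Real.cosh_sq z.im
    have h2 := Real.sin_sq_add_cos_sq z.re
    linear_combination Real.cos z.re ^ 2 * h1 + Real.sinh z.im ^ 2 * h2
  have hs : |z.im| ≤ |Real.sinh z.im| := by
    rw [Real.abs_sinh]
    exact Real.self_le_sinh_iff.2 (abs_nonneg _)
  refine hs.trans (abs_le_of_sq_le_sq' ?_ (norm_nonneg _) |> abs_le.2)
  nlinarith [sq_nonneg (Real.cos z.re)]

theorem norm_cos_le_exp_norm (z : ℂ) : ‖Complex.cos z‖ ≤ Real.exp ‖z‖ := by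
  have h1 : ‖Complex.exp (z * Complex.I)‖ ≤ Real.exp ‖z‖ := by
    simpa using Complex.norm_exp_le_exp_norm (z * Complex.I)
  have h2 : ‖Complex.exp (-z * Complex.I)‖ ≤ Real.exp ‖z‖ := by
    simpa using Complex.norm_exp_le_exp_norm (-z * Complex.I)
  rw [Complex.cos, norm_div, Complex.norm_two]
  linarith [norm_add_le (Complex.exp (z * Complex.I)) (Complex.exp (-z * Complex.I))]

/-- A holomorphic function on a disc omitting `1` and `-1` is of the form `cos (π F)`, with
control of `F` at the centre. -/
theorem exists_differentiableOn_cos_pi_mul_eq {f : ℂ → ℂ} {c : ℂ} {r : ℝ} (hr : 0 < r)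
    (hf : DifferentiableOn ℂ f (Metric.ball c r))
    (h1 : ∀ z ∈ Metric.ball c r, f z ≠ 1) (h2 : ∀ z ∈ Metric.ball c r, f z ≠ -1) :
    ∃ F : ℂ → ℂ, DifferentiableOn ℂ F (Metric.ball c r) ∧
      (∀ z ∈ Metric.ball c r, f z = Complex.cos (Real.pi * F z)) ∧ ‖F c‖ ≤ 1 + ‖f c‖ := by
  have hπ : (Real.pi : ℂ) ≠ 0 := by exact_mod_cast Real.pi_ne_zero
  obtain ⟨L, hLd, hL⟩ := exists_differentiableOn_exp_eq (f := fun z => 1 - f z ^ 2)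
    ((differentiableOn_const _).sub (hf.pow 2)) (fun z hz h => by
      have : (1 - f z) * (1 + f z) = 0 := by linear_combination h
      rcases mul_eq_zero.1 this with h | h
      · exact h1 z hz (by linear_combination -h)
      · exact h2 z hz (by linear_combination h))
  -- `S` is a square root of `1 - f²`; `f + iS` has inverse `f - iS`, so it has a logarithm, which
  -- serves as `iπF`.
  set S : ℂ → ℂ := fun z => Complex.exp (L z / 2) with hS
  have hSd : DifferentiableOn ℂ S (Metric.ball c r) := (hLd.div_const 2).cexp
  have hS2 : ∀ z ∈ Metric.ball c r, S z ^ 2 = 1 - f z ^ 2 := by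
    intro z hz
    rw [hL z hz, hS, ← Complex.exp_nat_mul]
    congr 1
    push_cast
    ring
  have hmul : ∀ z ∈ Metric.ball c r,
      (f z + Complex.I * S z) * (f z - Complex.I * S z) = 1 := by
    intro z hz
    linear_combination hS2 z hz - S z ^ 2 * Complex.I_sq
  obtain ⟨K, hKd, hK⟩ := exists_differentiableOn_exp_eq (f := fun z => f z + Complex.I * S z)
    (hf.add (hSd.const_mul _)) (fun z hz => left_ne_zero_of_mul_eq_one (hmul z hz))
  -- Subtracting a period of cosine brings the real part of `F c` into `[-1, 1]`.
  set k : ℤ := round ((K c).im / (2 * Real.pi)) with hk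
  set F : ℂ → ℂ := fun z => (-Complex.I * K z - k * (2 * Real.pi)) / Real.pi with hF
  have hFcos : ∀ z ∈ Metric.ball c r, f z = Complex.cos (Real.pi * F z) := by
    intro z hz
    have e : (Real.pi : ℂ) * F z = -Complex.I * K z - k * (2 * Real.pi) := by
      rw [hF]; field_simp
    have e1 : -Complex.I * K z * Complex.I = K z := by
      linear_combination -K z * Complex.I_sq
    have e2 : -(-Complex.I * K z) * Complex.I = - K z := by
      linear_combination K z * Complex.I_sq
    have e3 : Complex.exp (- K z) = f z - Complex.I * S z := by
      rw [Complex.exp_neg, ← hK z hz]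
      exact inv_eq_of_mul_eq_one_right (hmul z hz)
    rw [e, Complex.cos_sub_int_mul_two_pi, Complex.cos, e1, e2, e3, ← hK z hz]
    ring
  refine ⟨F, ((hKd.const_mul _).sub_const _).div_const _, hFcos, ?_⟩
  have hre : |(F c).re| ≤ 1 := by
    have e : (F c).re = 2 * ((K c).im / (2 * Real.pi) - k) := by
      have : F c = ((((K c).im - k * (2 * Real.pi)) / Real.pi : ℝ) : ℂ)
          + ((-(K c).re / Real.pi : ℝ) : ℂ) * Complex.I := by
        rw [hF]
        push_cast
        field_simp
        linear_combination Complex.I * Complex.re_add_im (K c) - (K c).im * Complex.I_sq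
      rw [this]
      simp only [Complex.add_re, Complex.ofReal_re, Complex.re_ofReal_mul, Complex.I_re, mul_zero,
        add_zero]
      have := Real.pi_ne_zero
      field_simp
    rw [e, abs_mul, abs_two]
    linarith [abs_sub_round ((K c).im / (2 * Real.pi))]
  have him : |(F c).im| ≤ ‖f c‖ := by
    have h := abs_im_le_norm_cos (Real.pi * F c)
    rw [← hFcos c (Metric.mem_ball_self hr), Complex.im_ofReal_mul, abs_mul,
      abs_of_pos Real.pi_pos] at h
    nlinarith [abs_nonneg (F c).im, Real.pi_gt_three]
  exact (Complex.norm_le_abs_re_add_abs_im _).trans (add_le_add hre him)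

/-! ### Bloch's theorem and the disc case -/

/-- Every complex number is within distance `3 / 2` of a point where `cos (π w)` is an integer. -/
theorem exists_dist_le_cos_pi_mul_eq_intCast (w : ℂ) :
    ∃ v : ℂ, dist v w ≤ 3 / 2 ∧ ∃ n : ℤ, Complex.cos (Real.pi * v) = n := by
  -- For integer `m`, `cos (π(m + iy)) = ±cosh (πy)`, and `cosh (πy)` passes an integer on each unit
  -- step. The errors are `1/2` in the real part and `1` in the imaginary part.
  set N : ℕ := ⌈Real.cosh (Real.pi * |w.im|)⌉₊ with hN
  have hpos := Real.cosh_pos (Real.pi * |w.im|)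
  have hle : Real.cosh (Real.pi * |w.im|) ≤ N := Nat.le_ceil _
  have hN2 : (N : ℝ) ≤ Real.cosh (Real.pi * (|w.im| + 1)) := by
    have h1 : (N : ℝ) < Real.cosh (Real.pi * |w.im|) + 1 := Nat.ceil_lt_add_one hpos.le
    have h2 : (3 : ℝ) ≤ Real.sinh Real.pi :=
      Real.pi_gt_three.le.trans (Real.self_le_sinh_iff.2 Real.pi_pos.le)
    have h3 : Real.sinh Real.pi < Real.cosh Real.pi := Real.sinh_lt_cosh _
    have h4 : 0 ≤ Real.sinh (Real.pi * |w.im|) := Real.sinh_nonneg_iff.2 (by positivity)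
    have h5 := Real.one_le_cosh (Real.pi * |w.im|)
    rw [mul_add, mul_one, Real.cosh_add]
    nlinarith [mul_nonneg h4 (by linarith : (0 : ℝ) ≤ Real.sinh Real.pi)]
  obtain ⟨y, hy, hyN⟩ : (N : ℝ) ∈ (fun y => Real.cosh (Real.pi * y)) ''
      Set.Icc |w.im| (|w.im| + 1) :=
    intermediate_value_Icc (by linarith)
      (Real.continuous_cosh.comp (continuous_const.mul continuous_id)).continuousOn ⟨hle, hN2⟩
  obtain ⟨y', hy', hyw⟩ : ∃ y' : ℝ, Real.cosh (Real.pi * y') = N ∧ |y' - w.im| ≤ 1 := by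
    rcases abs_cases w.im with ⟨h, -⟩ | ⟨h, -⟩
    · exact ⟨y, hyN, abs_le.2 ⟨by linarith [hy.1], by linarith [hy.2]⟩⟩
    · refine ⟨-y, by rw [mul_neg, Real.cosh_neg]; exact hyN,
        abs_le.2 ⟨by linarith [hy.2], by linarith [hy.1]⟩⟩
  set m : ℤ := round w.re with hm
  refine ⟨m + y' * Complex.I, ?_, m.negOnePow * N, ?_⟩
  · rw [dist_eq_norm]
    refine (Complex.norm_le_abs_re_add_abs_im _).trans ?_
    have h := abs_sub_round w.re
    rw [abs_sub_comm] at h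
    simp only [Complex.sub_re, Complex.add_re, Complex.intCast_re, Complex.mul_re,
      Complex.ofReal_re, Complex.I_re, Complex.ofReal_im, Complex.I_im, Complex.sub_im,
      Complex.add_im, Complex.intCast_im, Complex.mul_im]
    norm_num
    linarith
  · have e : (Real.pi : ℂ) * (m + y' * Complex.I)
        = ((m * Real.pi : ℝ) : ℂ) + ((Real.pi * y' : ℝ) : ℂ) * Complex.I := by
      push_cast
      ring
    rw [e, Complex.cos_add_mul_I, ← Complex.ofReal_sin, Real.sin_int_mul_pi, ← Complex.ofReal_cosh,
      hy', ← Complex.ofReal_cos, Real.cos_int_mul_pi]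
    rcases Int.even_or_odd m with h | h
    · simp [h.neg_one_zpow, Int.negOnePow_even m h]
    · simp [h.neg_one_zpow, Int.negOnePow_odd m h]

/-- **Bloch's theorem**, with a non-optimal constant. -/
theorem exists_ball_subset_image_closedBall {g : ℂ → ℂ} {c : ℂ} {ρ R : ℝ} (hρ : 0 < ρ)
    (hR : ρ < R) (hg : DifferentiableOn ℂ g (Metric.ball c R)) (hc : deriv g c ≠ 0) :
    ∃ w, Metric.ball w (ρ * ‖deriv g c‖ / 48) ⊆ g '' Metric.closedBall c ρ := by
  have hsub : Metric.closedBall c ρ ⊆ Metric.ball c R := Metric.closedBall_subset_ball hR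
  have hdg : DifferentiableOn ℂ (deriv g) (Metric.ball c R) := hg.deriv Metric.isOpen_ball
  -- The weight vanishes on the boundary, so around the maximum point `p`, up to half its distance
  -- to the boundary, `‖g'‖` at most doubles.
  obtain ⟨p, hp, hmax⟩ := (isCompact_closedBall c ρ).exists_isMaxOn
    (f := fun z => ‖deriv g z‖ * (ρ - dist z c)) ⟨c, Metric.mem_closedBall_self hρ.le⟩
    (((hdg.continuousOn.mono hsub).norm).mul (by fun_prop))
  rw [isMaxOn_iff] at hmax
  set A := ‖deriv g p‖ with hA
  have hcp : ‖deriv g c‖ * ρ ≤ A * (ρ - dist p c) := by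
    simpa using hmax c (Metric.mem_closedBall_self hρ.le)
  have hc0 : 0 < ‖deriv g c‖ := norm_pos_iff.2 hc
  have hpd : dist p c ≤ ρ := Metric.mem_closedBall.1 hp
  have hprod : 0 < A * (ρ - dist p c) := (mul_pos hc0 hρ).trans_le hcp
  have hA0 : 0 < A := pos_of_mul_pos_left hprod (by linarith)
  have hd0 : 0 < ρ - dist p c := pos_of_mul_pos_right hprod hA0.le
  obtain ⟨t, ht⟩ : ∃ t, t = (ρ - dist p c) / 2 := ⟨_, rfl⟩
  have ht0 : 0 < t := by linarith
  have hball : Metric.ball p t ⊆ Metric.closedBall c ρ := fun z hz => by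
    rw [Metric.mem_closedBall]
    linarith [dist_triangle z p c, Metric.mem_ball.1 hz]
  have hbound : ∀ z ∈ Metric.ball p t, ‖deriv g z‖ ≤ 2 * A := by
    intro z hz
    have h1 := hmax z (hball hz)
    have h2 : t ≤ ρ - dist z c := by linarith [dist_triangle z p c, Metric.mem_ball.1 hz]
    have h3 : ‖deriv g z‖ * t ≤ 2 * A * t := by
      have := mul_le_mul_of_nonneg_left h2 (norm_nonneg (deriv g z))
      rw [show ρ - dist p c = 2 * t by linarith] at h1
      linarith
    exact le_of_mul_le_mul_right h3 ht0
  -- Schwarz's lemma for `g'`, with oscillation at most `3A` on radius `t`.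
  have hosc : ∀ z ∈ Metric.closedBall p (t / 6), ‖deriv g z - deriv g p‖ ≤ A / 2 := by
    intro z hz
    rw [Metric.mem_closedBall] at hz
    have hmaps : Set.MapsTo (deriv g) (Metric.ball p t)
        (Metric.closedBall (deriv g p) (3 * A)) := fun w hw => by
      rw [mem_closedBall_iff_norm]
      linarith [norm_sub_le (deriv g w) (deriv g p), hbound w hw]
    have h := Complex.dist_le_div_mul_dist_of_mapsTo_ball
      (hdg.mono (hball.trans hsub)) hmaps (z := z) (Metric.mem_ball.2 (by linarith))
    rw [dist_eq_norm] at h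
    refine h.trans ((mul_le_mul_of_nonneg_left hz (by positivity)).trans_eq ?_)
    field_simp
    norm_num
  have hs0 : 0 < t / 6 := by linarith
  have hsub' : Metric.closedBall p (t / 6) ⊆ Metric.ball c R :=
    (Metric.closedBall_subset_ball (by linarith)).trans (hball.trans hsub)
  have hgd : ∀ z ∈ Metric.closedBall p (t / 6), HasDerivAt g (deriv g z) z := fun z hz =>
    (hg.differentiableAt (Metric.isOpen_ball.mem_nhds (hsub' hz))).hasDerivAt
  have hlow : ∀ z ∈ Metric.closedBall p (t / 6), A / 2 * dist z p ≤ ‖g z - g p‖ := by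
    intro z hz
    have h := (convex_closedBall p (t / 6)).norm_image_sub_le_of_norm_hasDerivWithin_le
      (f := fun z => g z - deriv g p * z) (f' := fun z => deriv g z - deriv g p)
      (fun w hw => by
        simpa using ((hgd w hw).fun_sub
          ((hasDerivAt_id w).const_mul (deriv g p))).hasDerivWithinAt)
      hosc (Metric.mem_closedBall_self hs0.le) hz
    have e : deriv g p * (z - p)
        = (g z - g p) - ((g z - deriv g p * z) - (g p - deriv g p * p)) := by ring
    have h' := norm_sub_le (g z - g p) ((g z - deriv g p * z) - (g p - deriv g p * p))
    rw [← e, norm_mul, ← hA] at h'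
    rw [dist_eq_norm]
    linarith
  refine ⟨g p, ?_⟩
  have hcover := DiffContOnCl.ball_subset_image_closedBall (f := g) (z₀ := p) (r := t / 6)
    (ε := A / 2 * (t / 6))
    ((hg.mono (Metric.closure_ball_subset_closedBall.trans hsub')).diffContOnCl) hs0
    (fun z hz => by
      have := hlow z (Metric.sphere_subset_closedBall hz)
      rwa [Metric.mem_sphere.1 hz] at this)
    (by
      have h := (hgd p (Metric.mem_closedBall_self hs0.le)).eventually_ne (c := g p)
        (norm_pos_iff.1 hA0)
      exact (h.frequently).filter_mono nhdsWithin_le_nhds)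
  refine (Metric.ball_subset_ball ?_).trans (hcover.trans (Set.image_mono
    ((Metric.closedBall_subset_ball (by linarith)).trans hball)))
  rw [show ρ - dist p c = 2 * t by linarith] at hcp
  linarith

/-- **Schottky's theorem** on the unit disc. -/
theorem exists_norm_le_of_omits_zero_one (M : ℝ) :
    ∃ C : ℝ, ∀ f : ℂ → ℂ, DifferentiableOn ℂ f (Metric.ball 0 1) →
      (∀ z ∈ Metric.ball (0 : ℂ) 1, f z ≠ 0 ∧ f z ≠ 1) → ‖f 0‖ ≤ M →
        ∀ z ∈ Metric.closedBall (0 : ℂ) (1 / 2), ‖f z‖ ≤ C := by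
  refine ⟨(Real.exp (Real.pi * Real.exp (Real.pi * (2 * M + 195))) + 1) / 2,
    fun f hf h01 hM z hz => ?_⟩
  obtain ⟨F, hFd, hF, hF0⟩ := exists_differentiableOn_cos_pi_mul_eq (f := fun z => 2 * f z - 1)
    one_pos ((hf.const_mul 2).sub_const 1)
    (fun z hz h => (h01 z hz).2 (by linear_combination h / 2))
    (fun z hz h => (h01 z hz).1 (by linear_combination h / 2))
  have hFint : ∀ z ∈ Metric.ball (0 : ℂ) 1, ∀ n : ℤ, F z ≠ n := by
    intro z hz n hn
    have h := hF z hz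
    have e : (Real.pi : ℂ) * F z = ((n * Real.pi : ℝ) : ℂ) := by
      rw [hn]
      push_cast
      ring
    rw [e, ← Complex.ofReal_cos, Real.cos_int_mul_pi] at h
    rcases Int.even_or_odd n with hn | hn
    · rw [hn.neg_one_zpow, Complex.ofReal_one] at h
      exact (h01 z hz).2 (by linear_combination h / 2)
    · rw [hn.neg_one_zpow, Complex.ofReal_neg, Complex.ofReal_one] at h
      exact (h01 z hz).1 (by linear_combination h / 2)
  obtain ⟨g, hgd, hg, hg0⟩ := exists_differentiableOn_cos_pi_mul_eq one_pos hFd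
    (fun z hz h => hFint z hz 1 (by simpa using h))
    (fun z hz h => hFint z hz (-1) (by simpa using h))
  -- A larger derivative would give a disc of radius over `384 / (4 * 48) = 2 > 3/2` in the image of
  -- `g`.
  have hderiv : ∀ z ∈ Metric.closedBall (0 : ℂ) (1 / 2), ‖deriv g z‖ ≤ 384 := by
    intro z hz
    by_contra! hlt
    have hsub : Metric.ball z (1 / 2) ⊆ Metric.ball 0 1 := fun v hv => by
      rw [Metric.mem_ball] at hv ⊢
      linarith [dist_triangle v z 0, Metric.mem_closedBall.1 hz]
    obtain ⟨w, hw⟩ := exists_ball_subset_image_closedBall (ρ := 1 / 4) (R := 1 / 2) (by norm_num)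
      (by norm_num) (hgd.mono hsub) (norm_pos_iff.1 (by linarith))
    obtain ⟨v, hvw, n, hn⟩ := exists_dist_le_cos_pi_mul_eq_intCast w
    obtain ⟨u, hu, rfl⟩ := hw (Metric.mem_ball.2 (by linarith : dist v w < _))
    have hu1 : u ∈ Metric.ball (0 : ℂ) 1 :=
      hsub (Metric.closedBall_subset_ball (by norm_num) hu)
    exact hFint u hu1 n ((hg u hu1).trans hn)
  have hz1 : z ∈ Metric.ball (0 : ℂ) 1 := Metric.closedBall_subset_ball (by norm_num) hz
  -- `‖g 0‖ ≤ 2M + 3`, and the half disc adds `384 / 2 = 192`.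
  have hgz : ‖g z‖ ≤ 2 * M + 195 := by
    have h := (convex_closedBall (0 : ℂ) (1 / 2)).norm_image_sub_le_of_norm_deriv_le
      (fun w hw => hgd.differentiableAt (Metric.isOpen_ball.mem_nhds
        (Metric.closedBall_subset_ball (by norm_num) hw))) hderiv
      (Metric.mem_closedBall_self (by norm_num)) hz
    have hz' : ‖z - 0‖ ≤ 1 / 2 := mem_closedBall_iff_norm.1 hz
    have h1 := norm_sub_le (2 * f 0) 1
    rw [norm_mul, Complex.norm_two, norm_one] at h1
    linarith [norm_sub_norm_le (g z) (g 0)]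
  have key : ∀ w : ℂ, ∀ B : ℝ, ‖w‖ ≤ B →
      ‖Complex.cos (Real.pi * w)‖ ≤ Real.exp (Real.pi * B) := by
    intro w B hB
    refine (norm_cos_le_exp_norm _).trans (Real.exp_le_exp.2 ?_)
    rw [norm_mul, Complex.norm_real, Real.norm_of_nonneg Real.pi_pos.le]
    exact mul_le_mul_of_nonneg_left hB Real.pi_pos.le
  have hFz := key _ _ hgz
  rw [← hg z hz1] at hFz
  have hfz := key _ _ hFz
  rw [← hF z hz1] at hfz
  have h2 := norm_sub_norm_le (2 * f z) 1
  rw [norm_mul, Complex.norm_two, norm_one] at h2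
  linarith

/-! ### From the disc to domains -/

/-- **Schottky's theorem** on balls of a complex normed space. -/
theorem exists_norm_le_of_omits_zero_one_of_ball_subset (E : Type*) [NormedAddCommGroup E]
    [NormedSpace ℂ E] (M : ℝ) :
    ∃ C : ℝ, ∀ (f : E → ℂ) (p : E) (r : ℝ), DifferentiableOn ℂ f (Metric.ball p r) →
      (∀ z ∈ Metric.ball p r, f z ≠ 0 ∧ f z ≠ 1) → ‖f p‖ ≤ M →
        ∀ z ∈ Metric.ball p (r / 2), ‖f z‖ ≤ C := by
  obtain ⟨C, hC⟩ := exists_norm_le_of_omits_zero_one M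
  refine ⟨C, fun f p r hf h01 hM z hz => ?_⟩
  -- The complex line through `p` and `z`, scaled so that `φ (1/2) = z`.
  set φ : ℂ → E := fun t => p + t • ((2 : ℂ) • (z - p)) with hφ
  have hmaps : Set.MapsTo φ (Metric.ball 0 1) (Metric.ball p r) := by
    intro t ht
    rw [mem_ball_iff_norm] at hz
    rw [mem_ball_zero_iff] at ht
    rw [mem_ball_iff_norm, hφ, add_sub_cancel_left, norm_smul, norm_smul, Complex.norm_two]
    nlinarith [norm_nonneg (z - p), norm_nonneg t]
  have h := hC (f ∘ φ) (hf.comp (by fun_prop) hmaps) (fun t ht => h01 _ (hmaps ht))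
    (by simpa [hφ] using hM) (1 / 2) (by simp)
  simpa [hφ, smul_smul] using h

/-- **Schottky's theorem** on compact subsets of a connected open set. -/
theorem IsCompact.exists_norm_le_of_omits_zero_one {E : Type*} [NormedAddCommGroup E]
    [NormedSpace ℂ E] {Ω K : Set E} (hK : IsCompact K) (hKΩ : K ⊆ Ω) (hΩ : IsOpen Ω)
    (hconn : IsPreconnected Ω) {a : E} (ha : a ∈ Ω) (M : ℝ) :
    ∃ C : ℝ, ∀ f : E → ℂ, DifferentiableOn ℂ f Ω → (∀ z ∈ Ω, f z ≠ 0 ∧ f z ≠ 1) →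
      ‖f a‖ ≤ M → ∀ z ∈ K, ‖f z‖ ≤ C := by
  let P : Set E → Prop := fun s => ∃ C : ℝ, ∀ f : E → ℂ, DifferentiableOn ℂ f Ω →
    (∀ z ∈ Ω, f z ≠ 0 ∧ f z ≠ 1) → ‖f a‖ ≤ M → ∀ z ∈ s, ‖f z‖ ≤ C
  have hmono : ∀ ⦃s t : Set E⦄, s ⊆ t → P t → P s := fun s t hst ⟨C, hC⟩ =>
    ⟨C, fun f hf h01 hM z hz => hC f hf h01 hM z (hst hz)⟩
  have hspread : ∀ p r, Metric.ball p r ⊆ Ω → P {p} → P (Metric.ball p (r / 2)) := by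
    rintro p r hpr ⟨B, hB⟩
    obtain ⟨C, hC⟩ := exists_norm_le_of_omits_zero_one_of_ball_subset E B
    exact ⟨C, fun f hf h01 hM z hz => hC f p r (hf.mono hpr) (fun w hw => h01 w (hpr hw))
      (hB f hf h01 hM p rfl) z hz⟩
  have hnhds : ∀ p ∈ Ω, P {p} → ∃ t ∈ nhds p, P t := by
    intro p hp hPp
    obtain ⟨r, hr, hpr⟩ := Metric.isOpen_iff.1 hΩ p hp
    exact ⟨_, Metric.ball_mem_nhds p (half_pos hr), hspread p r hpr hPp⟩
  -- The points having a neighbourhood with a uniform bound form an open set, relatively closed in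
  -- `Ω`, that contains `a`.
  have hall : Ω ⊆ {p | P {p}} := by
    refine hconn.subset_of_closure_inter_subset (u := {p | ∃ t ∈ nhds p, P t}) ?_ ?_ ?_ |>.trans ?_
    · rw [isOpen_iff_mem_nhds]
      rintro p ⟨t, ht, hPt⟩
      filter_upwards [eventually_mem_nhds_iff.2 ht] with q hq
      exact ⟨t, hq, hPt⟩
    · exact ⟨a, ha, hnhds a ha ⟨M, fun f _ _ hM z hz => by rwa [Set.mem_singleton_iff.1 hz]⟩⟩
    · rintro p ⟨hp, hpΩ⟩
      obtain ⟨r, hr, hpr⟩ := Metric.isOpen_iff.1 hΩ p hpΩ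
      obtain ⟨q, ⟨t, ht, hPt⟩, hpq⟩ := Metric.mem_closure_iff.1 hp (r / 4) (by linarith)
      refine ⟨Metric.ball q (r / 2 / 2), Metric.isOpen_ball.mem_nhds
        (Metric.mem_ball.2 (by linarith)), hspread q (r / 2) (fun z hz => hpr ?_)
        (hmono (Set.singleton_subset_iff.2 (mem_of_mem_nhds ht)) hPt)⟩
      rw [Metric.mem_ball] at hz ⊢
      linarith [dist_triangle z q p, dist_comm p q]
    · rintro p ⟨t, ht, hPt⟩
      exact hmono (Set.singleton_subset_iff.2 (mem_of_mem_nhds ht)) hPt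
  refine hK.induction_on (p := P) ⟨0, by simp⟩ hmono ?_ ?_
  · rintro s t ⟨C, hC⟩ ⟨D, hD⟩
    refine ⟨max C D, fun f hf h01 hM z hz => ?_⟩
    rcases hz with hz | hz
    · exact (hC f hf h01 hM z hz).trans (le_max_left _ _)
    · exact (hD f hf h01 hM z hz).trans (le_max_right _ _)
  · intro p hp
    obtain ⟨t, ht, hPt⟩ := hnhds p (hKΩ hp) (hall (hKΩ hp))
    exact ⟨t, mem_nhdsWithin_of_mem_nhds ht, hPt⟩

/-- The points of a bounded open set at distance at least `ε > 0` from its boundary form a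
compact set. -/
theorem IsOpen.isCompact_setOf_le_infDist_frontier {E : Type*} [PseudoMetricSpace E]
    [ProperSpace E] {Ω : Set E} (hΩ : IsOpen Ω) (hb : Bornology.IsBounded Ω) {ε : ℝ}
    (hε : 0 < ε) : IsCompact {z ∈ Ω | ε ≤ Metric.infDist z (frontier Ω)} := by
  -- Boundary points have distance `0 < ε`, so `Ω` may be replaced by its compact closure.
  have e : {z ∈ Ω | ε ≤ Metric.infDist z (frontier Ω)}
      = closure Ω ∩ {z | ε ≤ Metric.infDist z (frontier Ω)} := by
    ext z
    refine ⟨fun h => ⟨subset_closure h.1, h.2⟩, fun ⟨hz, hzε⟩ => ⟨?_, hzε⟩⟩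
    by_contra hzΩ
    have hzf : z ∈ frontier Ω := ⟨hz, by rwa [hΩ.interior_eq]⟩
    have : ε ≤ Metric.infDist z (frontier Ω) := hzε
    rw [Metric.infDist_zero_of_mem hzf] at this
    linarith
  rw [e]
  exact hb.isCompact_closure.inter_right
    (isClosed_le continuous_const (Metric.continuous_infDist_pt _))

theorem mainTheorem1 (n : ℕ) (hn : 1 ≤ n)
    (Ω : Set (EuclideanSpace ℂ (Fin n)))
    (hΩ_open : IsOpen Ω) (hΩ_conn : IsConnected Ω) (hΩ_bdd : Bornology.IsBounded Ω)
    (a : EuclideanSpace ℂ (Fin n)) (ha : a ∈ Ω)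
    (M ε : ℝ) (hε : 0 < ε) :
    ∃ C : ℝ, 0 < C ∧
      ∀ f : EuclideanSpace ℂ (Fin n) → ℂ,
        DifferentiableOn ℂ f Ω →
        (∀ z ∈ Ω, f z ≠ 0 ∧ f z ≠ 1) →
        ‖f a‖ < M →
        ∀ z ∈ Ω, ε ≤ Metric.infDist z (frontier Ω) → ‖f z‖ < C := by
  obtain ⟨C, hC⟩ := (hΩ_open.isCompact_setOf_le_infDist_frontier
    hΩ_bdd hε).exists_norm_le_of_omits_zero_one (fun z hz => hz.1) hΩ_open
    hΩ_conn.isPreconnected ha M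
  refine ⟨max C 0 + 1, by positivity, fun f hf h01 hM z hz hzε => ?_⟩
  linarith [hC f hf h01 hM.le z ⟨hz, hzε⟩, le_max_left C 0]
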